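/- An effect algebra is a set $E$ with constants $0,1$ and a partial operation $+$ such that for all $a,b,c\in E$: (i) $a+b$ is defined iff $b+a$ is, and then $a+b=b+a$; (ii) $a+b$ and $(a+b)+c$ are defined iff $b+c$ and $a+(b+c)$ are, and then $(a+b)+c=a+(b+c)$; (iii) there is a unique $a'\in E$ with $a+a'=1$; (iv) if $a+1$ is defined, then $a=0$. It is partially ordered by $a\le b$ iff $a+c=b$ for some $c\in E$. $E$ has (RDP) if $x_1+x_2=y_1+y_2$ implies that there are $c_{11},c_{12},c_{21},c_{22}\in E$ with $x_1=c_{11}+c_{12}$, $x_2=c_{21}+c_{22}$, $y_1=c_{11}+c_{21}$, $y_2=c_{12}+c_{22}$. It has countable interpolation if, for all sequences $(a_i)$, $(b_j)$ in $E$ with $a_i\le b_j$ for all $i,j$, there is $c\in E$ with $a_i\le c\le b_j$ for all $i,j$. It is monotone $\sigma$-complete if every ascending sequence bounded above in $E$ has a supremum in $E$ and every descending sequence bounded below in $E$ has an infimum in $E$. A state on $E$ is a map $s:E\to[0,1]$ with $s(1)=1$ and $s(a+b)=s(a)+s(b)$ whenever $a+b$ is defined. It is extremal if $s=\lambda s_1+(1-\lambda)s_2$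 with states $s_1,s_2$ and $\lambda\in(0,1)$ implies $s=s_1=s_2$. A $\sigma$-convex combination of a finite or countable family of states $(s_n)$ is a pointwise sum $s=\sum_n\lambda_n s_n$ with $\lambda_n\ge 0$ and $\sum_n\lambda_n=1$. A state $s$ is Jauch–Piron if for all $a,b\in E$ with $s(a)=s(b)=1$ there is $c\in E$ with $c\le a$, $c\le b$ and $s(c)=1$. **Proposition.** Let $E$ be an effect algebra with (RDP). 1. If $E$ is monotone $\sigma$-complete, then $E$ has countable interpolation. 2. If $E$ has countable interpolation (in particular, by 1, if $E$ is monotone $\sigma$-complete), then every $\sigma$-convex combination of extremal states on $E$ is a state on $E$, and it is Jauch–Piron. -/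

import Mathlib

/-- An effect algebra `(E; +, 0, 1)`. The partial operation is `padd : E → E → Option E`:
`padd a b = some c` means that `a + b` is defined and equals `c`, and `padd a b = none` means
that `a + b` is not defined. -/
class EffectAlgebra (E : Type*) extends Zero E, One E where
  /-- The partial addition. -/
  padd : E → E → Option E
  /-- `a + b` is defined iff `b + a` is, and then they are equal. -/
  padd_comm : ∀ a b : E, padd a b = padd b a
  /-- `a + b` and `(a + b) + c` are defined iff `b + c` and `a + (b + c)` are, and then
  `(a + b) + c = a + (b + c)`. -/
  padd_assoc : ∀ a b c : E,
    ((padd a b).bind fun d => padd d c) = ((padd b c).bind fun d => padd a d)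
  /-- Every element has a unique orthosupplement. -/
  existsUnique_compl : ∀ a : E, ∃! a' : E, padd a a' = some 1
  /-- If `a + 1` is defined then `a = 0`. -/
  eq_zero_of_padd_one : ∀ a : E, (padd a 1).isSome → a = 0

namespace EffectAlgebra

section Order

variable {E : Type*} [EffectAlgebra E]

theorem assoc_left {a b c d e : E} (h₁ : padd a b = some d) (h₂ : padd d c = some e) :
    ∃ f, padd b c = some f ∧ padd a f = some e := by
  have h := padd_assoc a b c
  rw [h₁, Option.bind_some, h₂] at h
  exact Option.bind_eq_some_iff.mp h.symm

theorem assoc_right {a b c f e : E} (h₁ : padd b c = some f) (h₂ : padd a f = some e) :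
    ∃ d, padd a b = some d ∧ padd d c = some e := by
  have h := padd_assoc a b c
  rw [h₁, Option.bind_some, h₂] at h
  exact Option.bind_eq_some_iff.mp h

theorem padd_zero (a : E) : padd a 0 = some a := by
  obtain ⟨z, hz, -⟩ := existsUnique_compl (1 : E)
  have hz0 : z = 0 := eq_zero_of_padd_one z (by rw [padd_comm, hz]; rfl)
  rw [hz0] at hz
  obtain ⟨a', ha, -⟩ := existsUnique_compl a
  rw [padd_comm] at ha
  obtain ⟨f, hf, hf'⟩ := assoc_left ha hz
  obtain ⟨x, -, hx⟩ := existsUnique_compl a'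
  rw [hf, hx f hf', hx a ha]

theorem eq_zero_of_padd_eq_self {a c : E} (h : padd a c = some a) : c = 0 := by
  obtain ⟨a', ha, -⟩ := existsUnique_compl a
  rw [padd_comm] at h
  obtain ⟨f, hf, hf'⟩ := assoc_left h ha
  rw [ha] at hf
  obtain rfl := Option.some.inj hf
  exact eq_zero_of_padd_one c (by rw [hf']; rfl)

theorem eq_zero_of_padd_eq_zero {a b : E} (h : padd a b = some 0) : b = 0 := by
  have h1 : padd (0 : E) 1 = some 1 := by rw [padd_comm, padd_zero]
  obtain ⟨f, hf, -⟩ := assoc_left h h1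
  exact eq_zero_of_padd_one b (by rw [hf]; rfl)

/-- The order of an effect algebra: `a ≤ b` iff `a + c = b` for some `c`. -/
instance instPartialOrder : PartialOrder E where
  le a b := ∃ c, padd a c = some b
  le_refl a := ⟨0, padd_zero a⟩
  le_trans := by
    rintro a b c ⟨d, hd⟩ ⟨e, he⟩
    obtain ⟨f, -, hf⟩ := assoc_left hd he
    exact ⟨f, hf⟩
  le_antisymm := by
    rintro a b ⟨c, hc⟩ ⟨d, hd⟩
    obtain ⟨f, hf, hf'⟩ := assoc_left hc hd
    rw [eq_zero_of_padd_eq_self hf'] at hf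
    rw [eq_zero_of_padd_eq_zero hf, padd_zero] at hd
    exact (Option.some.inj hd).symm

end Order

/-- The Riesz decomposition property (RDP): if `x₁ + x₂ = y₁ + y₂`, then there are
`c₁₁, c₁₂, c₂₁, c₂₂` with `x₁ = c₁₁ + c₁₂`, `x₂ = c₂₁ + c₂₂`, `y₁ = c₁₁ + c₂₁`,
`y₂ = c₁₂ + c₂₂`. -/
def RDP (E : Type*) [EffectAlgebra E] : Prop :=
  ∀ x₁ x₂ y₁ y₂ z : E, padd x₁ x₂ = some z → padd y₁ y₂ = some z →
    ∃ c₁₁ c₁₂ c₂₁ c₂₂ : E,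
      padd c₁₁ c₁₂ = some x₁ ∧ padd c₂₁ c₂₂ = some x₂ ∧
      padd c₁₁ c₂₁ = some y₁ ∧ padd c₁₂ c₂₂ = some y₂

/-- The countable interpolation property of a poset. -/
def CountableInterpolation (P : Type*) [PartialOrder P] : Prop :=
  ∀ a b : ℕ → P, (∀ i j, a i ≤ b j) → ∃ c : P, (∀ i, a i ≤ c) ∧ (∀ j, c ≤ b j)

/-- Monotone σ-completeness: ascending sequences that are bounded above have suprema, and
descending sequences that are bounded below have infima. -/
def MonotoneSigmaComplete (P : Type*) [PartialOrder P] : Prop :=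
  (∀ x : ℕ → P, Monotone x → BddAbove (Set.range x) → ∃ y, IsLUB (Set.range x) y) ∧
  (∀ x : ℕ → P, Antitone x → BddBelow (Set.range x) → ∃ y, IsGLB (Set.range x) y)

/-- The set of all states on `E`: maps `s : E → [0,1]` with `s 1 = 1` and
`s (a + b) = s a + s b` whenever `a + b` is defined. -/
def stateSpace (E : Type*) [EffectAlgebra E] : Set (E → ℝ) :=
  {s | (∀ a, s a ∈ Set.Icc (0 : ℝ) 1) ∧ s 1 = 1 ∧
    ∀ a b c : E, padd a b = some c → s c = s a + s b}

/-- A state is extremal if it is an extreme point of the convex set of all states. -/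
def IsExtremalState {E : Type*} [EffectAlgebra E] (s : E → ℝ) : Prop :=
  s ∈ (stateSpace E).extremePoints ℝ

/-- `s` is the σ-convex combination `∑ i, w i • t i`, the sum being taken pointwise. -/
def IsSigmaConvexCombination {E ι : Type*} (w : ι → ℝ) (t : ι → E → ℝ) (s : E → ℝ) : Prop :=
  (∀ i, 0 ≤ w i) ∧ HasSum w 1 ∧ ∀ a : E, HasSum (fun i => w i * t i a) (s a)

/-- A Jauch–Piron state: a state `s` such that whenever `s a = s b = 1`, there is `c ≤ a, b`
with `s c = 1`. -/
def IsJauchPironState {E : Type*} [EffectAlgebra E] (s : E → ℝ) : Prop :=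
  s ∈ stateSpace E ∧
    ∀ a b : E, s a = 1 → s b = 1 → ∃ c : E, c ≤ a ∧ c ≤ b ∧ s c = 1

end EffectAlgebra

/-!
Interpolation between pairs follows from two Riesz refinements. It says that the upper bounds of a
pair are directed downwards, so below any sequence of such upper bounds, term by term, there is a
descending one, whose infimum interpolates. Hence the lower bounds of a sequence are directed
upwards, and the same argument with suprema interpolates between two sequences.

For the Jauch–Piron property, refine `a + a' = 1 = b + b'`: the piece `c` common to `a` and `b`
satisfies `b = c + e` with `e ≤ a'`, and a state with `s a = 1` vanishes on `a'`.
-/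

namespace EffectAlgebra

section Addition

variable {E : Type*} [EffectAlgebra E] {a b c d e : E}

theorem padd_left_cancel (hb : padd a b = some d) (hc : padd a c = some d) : b = c := by
  obtain ⟨d', hd, -⟩ := existsUnique_compl d
  rw [padd_comm] at hb hc
  obtain ⟨f, hf, hbf⟩ := assoc_left hb hd
  obtain ⟨g, hg, hcg⟩ := assoc_left hc hd
  obtain rfl : f = g := Option.some.inj (hf.symm.trans hg)
  rw [padd_comm] at hbf hcg
  exact (existsUnique_compl f).unique hbf hcg

theorem le_of_padd_left (h : padd a b = some c) : a ≤ c :=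
  ⟨b, h⟩

theorem le_of_padd_right (h : padd a b = some c) : b ≤ c :=
  le_of_padd_left (padd_comm a b ▸ h)

theorem exists_padd_le_of_le_right (hbc : b ≤ c) (h : padd a c = some d) :
    ∃ e, padd a b = some e ∧ e ≤ d := by
  obtain ⟨x, hx⟩ := hbc
  obtain ⟨e, he, hed⟩ := assoc_right hx h
  exact ⟨e, he, le_of_padd_left hed⟩

theorem padd_le_padd_left (hbc : b ≤ c) (hb : padd a b = some d) (hc : padd a c = some e) :
    d ≤ e := by
  obtain ⟨d', hd', hde⟩ := exists_padd_le_of_le_right hbc hc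
  obtain rfl : d' = d := Option.some.inj (hd'.symm.trans hb)
  exact hde

theorem padd_le_padd_right (hab : a ≤ b) (ha : padd a c = some d) (hb : padd b c = some e) :
    d ≤ e :=
  padd_le_padd_left hab (padd_comm a c ▸ ha) (padd_comm b c ▸ hb)

end Addition

section FiniteInterpolation

/-- The (finite) interpolation property of a preorder: any two elements lying below two others
can be separated from them by a single element. -/
def FiniteInterpolation (P : Type*) [Preorder P] : Prop :=
  ∀ a₁ a₂ b₁ b₂ : P, a₁ ≤ b₁ → a₁ ≤ b₂ → a₂ ≤ b₁ → a₂ ≤ b₂ →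
    ∃ c, a₁ ≤ c ∧ a₂ ≤ c ∧ c ≤ b₁ ∧ c ≤ b₂

variable {E : Type*} [EffectAlgebra E]

theorem RDP.exists_padd_eq_of_le_padd (hE : RDP E) {x y₁ y₂ z : E} (hxz : x ≤ z)
    (hz : padd y₁ y₂ = some z) : ∃ x₁ x₂, padd x₁ x₂ = some x ∧ x₁ ≤ y₁ ∧ x₂ ≤ y₂ := by
  obtain ⟨x', hx'⟩ := hxz
  obtain ⟨x₁, x₂, _, _, hx, -, hy₁, hy₂⟩ := hE _ _ _ _ _ hx' hz
  exact ⟨x₁, x₂, hx, le_of_padd_left hy₁, le_of_padd_left hy₂⟩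

theorem RDP.finiteInterpolation (hE : RDP E) : FiniteInterpolation E := by
  rintro a₁ a₂ b₁ b₂ ⟨x, hx⟩ ⟨u, hu⟩ ⟨y, hy⟩ ⟨v, hv⟩
  obtain ⟨r, p, q, t, ha₁, hqt, ha₂, -⟩ := hE _ _ _ _ _ hx hy
  have hqx : q ≤ x := le_of_padd_left hqt
  -- Cancelling `r` in `b₂ = (r + p) + u = (r + q) + v` gives `p + u = q + v`, so `q ≤ p + u`.
  obtain ⟨f, hf, hrf⟩ := assoc_left ha₁ hu
  obtain ⟨g, hg, hrg⟩ := assoc_left ha₂ hv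
  obtain rfl : f = g := padd_left_cancel hrf hrg
  obtain ⟨d, q', hq, hdp, hq'u⟩ := hE.exists_padd_eq_of_le_padd (le_of_padd_left hg) hf
  -- The interpolant is `c = a₁ + q'`; it dominates `a₂ = (r + d) + q'` since `r + d ≤ r + p = a₁`.
  obtain ⟨c, hc, hcb₂⟩ := exists_padd_le_of_le_right hq'u hu
  obtain ⟨k, hk, hka₂⟩ := assoc_right hq ha₂
  have hka₁ : k ≤ a₁ := padd_le_padd_left hdp hk ha₁
  have hq'x : q' ≤ x := (le_of_padd_right hq).trans hqx
  exact ⟨c, le_of_padd_left hc, padd_le_padd_right hka₁ hka₂ hc, padd_le_padd_left hq'x hc hx,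
    hcb₂⟩

end FiniteInterpolation

section CountableInterpolation

theorem exists_monotone_seq_ge_of_directedOn {P : Type*} [Preorder P] {S : Set P}
    (hS : DirectedOn (· ≤ ·) S) {a : ℕ → P} (ha : ∀ n, a n ∈ S) :
    ∃ x : ℕ → P, Monotone x ∧ (∀ n, x n ∈ S) ∧ ∀ n, a n ≤ x n := by
  choose F hFS hle_F ha_F using fun (n : ℕ) (d : S) => hS d d.2 (a n) (ha n)
  let x : ℕ → S := Nat.rec ⟨a 0, ha 0⟩ fun n d => ⟨F (n + 1) d, hFS (n + 1) d⟩
  refine ⟨fun n => (x n).1, monotone_nat_of_le_succ fun n => hle_F (n + 1) (x n),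
    fun n => (x n).2, ?_⟩
  rintro (_ | n)
  · exact le_rfl
  · exact ha_F (n + 1) (x n)

theorem exists_antitone_seq_le_of_directedOn {P : Type*} [Preorder P] {S : Set P}
    (hS : DirectedOn (· ≥ ·) S) {b : ℕ → P} (hb : ∀ n, b n ∈ S) :
    ∃ x : ℕ → P, Antitone x ∧ (∀ n, x n ∈ S) ∧ ∀ n, x n ≤ b n :=
  exists_monotone_seq_ge_of_directedOn (P := Pᵒᵈ) hS hb

theorem FiniteInterpolation.directedOn_Ici_inter_Ici {P : Type*} [Preorder P]
    (hP : FiniteInterpolation P) (a₁ a₂ : P) : DirectedOn (· ≥ ·) (Set.Ici a₁ ∩ Set.Ici a₂) := by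
  rintro b₁ ⟨h₁₁, h₂₁⟩ b₂ ⟨h₁₂, h₂₂⟩
  obtain ⟨c, ha₁c, ha₂c, hcb₁, hcb₂⟩ := hP a₁ a₂ b₁ b₂ h₁₁ h₁₂ h₂₁ h₂₂
  exact ⟨c, ⟨ha₁c, ha₂c⟩, hcb₁, hcb₂⟩

variable {P : Type*} [PartialOrder P]

theorem MonotoneSigmaComplete.directedOn_lowerBounds_range (hσ : MonotoneSigmaComplete P)
    (hP : FiniteInterpolation P) (b : ℕ → P) :
    DirectedOn (· ≤ ·) (lowerBounds (Set.range b)) := by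
  intro a₁ ha₁ a₂ ha₂
  obtain ⟨x, hx, hxS, hxb⟩ := exists_antitone_seq_le_of_directedOn
    (hP.directedOn_Ici_inter_Ici a₁ a₂) fun n => ⟨ha₁ ⟨n, rfl⟩, ha₂ ⟨n, rfl⟩⟩
  have ha₁x : a₁ ∈ lowerBounds (Set.range x) := Set.forall_mem_range.2 fun n => (hxS n).1
  have ha₂x : a₂ ∈ lowerBounds (Set.range x) := Set.forall_mem_range.2 fun n => (hxS n).2
  obtain ⟨c, hc⟩ := hσ.2 x hx ⟨a₁, ha₁x⟩
  have hcb : c ∈ lowerBounds (Set.range b) :=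
    Set.forall_mem_range.2 fun n => (hc.1 ⟨n, rfl⟩).trans (hxb n)
  exact ⟨c, hcb, hc.2 ha₁x, hc.2 ha₂x⟩

theorem MonotoneSigmaComplete.countableInterpolation (hσ : MonotoneSigmaComplete P)
    (hP : FiniteInterpolation P) : CountableInterpolation P := by
  intro a b hab
  obtain ⟨x, hx, hxS, hax⟩ := exists_monotone_seq_ge_of_directedOn
    (hσ.directedOn_lowerBounds_range hP b) fun i => Set.forall_mem_range.2 (hab i)
  have hxb (j : ℕ) : b j ∈ upperBounds (Set.range x) :=
    Set.forall_mem_range.2 fun n => hxS n ⟨j, rfl⟩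
  obtain ⟨c, hc⟩ := hσ.1 x hx ⟨b 0, hxb 0⟩
  exact ⟨c, fun i => (hax i).trans (hc.1 ⟨i, rfl⟩), fun j => hc.2 (hxb j)⟩

end CountableInterpolation

section States

variable {E : Type*} [EffectAlgebra E] {s : E → ℝ}

theorem IsSigmaConvexCombination.mem_stateSpace {ι : Type*} {w : ι → ℝ} {t : ι → E → ℝ}
    (h : IsSigmaConvexCombination w t s) (ht : ∀ i, t i ∈ stateSpace E) : s ∈ stateSpace E := by
  obtain ⟨hw, hw_sum, hs⟩ := h
  refine ⟨fun a => ⟨?_, ?_⟩, ?_, fun a b c habc => ?_⟩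
  · exact (hs a).nonneg fun i => mul_nonneg (hw i) ((ht i).1 a).1
  · exact hasSum_le (fun i => mul_le_of_le_one_right (hw i) ((ht i).1 a).2) (hs a) hw_sum
  · refine (hs 1).unique ?_
    simpa only [(ht _).2.1, mul_one] using hw_sum
  · refine (hs c).unique ?_
    simpa only [(ht _).2.2 a b c habc, mul_add] using (hs a).add (hs b)

theorem monotone_of_mem_stateSpace (hs : s ∈ stateSpace E) : Monotone s := by
  rintro a b ⟨c, hc⟩
  rw [hs.2.2 a c b hc]
  exact le_add_of_nonneg_right (hs.1 c).1

theorem RDP.isJauchPironState (hE : RDP E) (hs : s ∈ stateSpace E) : IsJauchPironState s := by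
  refine ⟨hs, fun a b ha hb => ?_⟩
  obtain ⟨a', ha', -⟩ := existsUnique_compl a
  obtain ⟨b', hb', -⟩ := existsUnique_compl b
  obtain ⟨c, d, e, f, hcd, hef, hce, -⟩ := hE _ _ _ _ _ ha' hb'
  have hsa' : s a' = 0 := by linarith [hs.2.2 a a' 1 ha', hs.2.1]
  have hse : s e = 0 :=
    le_antisymm (hsa' ▸ monotone_of_mem_stateSpace hs (le_of_padd_left hef)) (hs.1 e).1
  refine ⟨c, le_of_padd_left hcd, le_of_padd_left hce, ?_⟩
  linarith [hs.2.2 c e b hce]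

end States

end EffectAlgebra

theorem mainTheorem5_general {E : Type*} [EffectAlgebra E] (hRDP : EffectAlgebra.RDP E) :
    (EffectAlgebra.MonotoneSigmaComplete E → EffectAlgebra.CountableInterpolation E) ∧
    ∀ {ι : Type*} (w : ι → ℝ) (t : ι → E → ℝ) (s : E → ℝ),
      (∀ i, t i ∈ EffectAlgebra.stateSpace E) →
      EffectAlgebra.IsSigmaConvexCombination w t s →
      EffectAlgebra.IsJauchPironState s :=
  ⟨fun hσ => hσ.countableInterpolation hRDP.finiteInterpolation,
    fun _ _ _ ht h => hRDP.isJauchPironState (h.mem_stateSpace ht)⟩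

theorem mainTheorem5 {E : Type*} [EffectAlgebra E] (hRDP : EffectAlgebra.RDP E) :
    (EffectAlgebra.MonotoneSigmaComplete E → EffectAlgebra.CountableInterpolation E) ∧
    (EffectAlgebra.CountableInterpolation E →
      ∀ {ι : Type*} [Countable ι] (w : ι → ℝ) (t : ι → E → ℝ) (s : E → ℝ),
        (∀ i, EffectAlgebra.IsExtremalState (t i)) →
        EffectAlgebra.IsSigmaConvexCombination w t s →
        EffectAlgebra.IsJauchPironState s) :=
  (mainTheorem5_general hRDP).imp_right fun h _ _ _ w t s ht => h w t s fun i => (ht i).1
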